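/- Let $K$ be a field; all coalgebras and comodules are over $K$ (coassociative and counital). A left (right) comodule is Artinian if it satisfies the descending chain condition on left (right) subcomodules; a coalgebra $C$ is left (right) Artinian if it is Artinian as a left (right) comodule over itself; a left (right) $C$-comodule is finitely cogenerated if it embeds, as a comodule, into $C^n$ for some positive integer $n$. Let $D,E$ be coalgebras and $M$ a $D$-$E$-bicomodule, with left coaction $m\mapsto m_{[-1]}\otimes m_{[0]}\in D\otimes M$ and right coaction $m\mapsto m_{(0)}\otimes m_{(1)}\in M\otimes E$. Let $\begin{pmatrix} D & M\\ 0& E\end{pmatrix}$ denote the upper triangular comatrix coalgebra, i.e. the space $D\oplus M\oplus E$ with $\Delta(d)=d_1\otimes d_2$, $\Delta(m)=m_{[-1]}\otimes m_{[0]}+m_{(0)}\otimes m_{(1)}$, $\Delta(e)=e_1\otimes e_2$, and counit $\varepsilon(d+m+e)=\varepsilon_D(d)+\varepsilon_E(e)$. 1. $\begin{pmatrix} D & M\\ 0& E\end{pmatrix}$ is left Artinian if and only if $D$ and $E$ are left Artinian and $M$ is finitely cogenerated as a left $D$-comodule. It is right Artinian if and only if $D$ and $E$ are right Artinian and $M$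 is finitely cogenerated as a right $E$-comodule. 2. If $D$ is an infinite dimensional left Artinian coalgebra, then $\begin{pmatrix} D & D\\ 0& K\end{pmatrix}$, where the entry $D$ in the upper right corner is the regular left $D$-comodule with right $K$-coaction $d\mapsto d\otimes 1$, is left Artinian but not right Artinian. 3. The divided power coalgebra (basis $c_0,c_1,c_2,\dots$, $\Delta(c_n)=\sum_{i+j=n}c_i\otimes c_j$, $\varepsilon(c_n)=\delta_{n,0}$) is infinite dimensional and both left and right Artinian. Hence, taking it for $D$ in part 2, one obtains over every field $K$ a coalgebra that is left Artinian but not right Artinian. -/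

import Mathlib

open scoped TensorProduct

/-- A left comodule structure on `M` over the `K`-coalgebra `D`: a coaction `M → D ⊗ M` that is
coassociative and counital. -/
structure LeftComodule (K D M : Type*) [Field K] [AddCommGroup D] [Module K D] [Coalgebra K D]
    [AddCommGroup M] [Module K M] where
  coact : M →ₗ[K] D ⊗[K] M
  coassoc : TensorProduct.assoc K D D M ∘ₗ (Coalgebra.comul (R := K) (A := D)).rTensor M ∘ₗ coact
    = coact.lTensor D ∘ₗ coact
  counit_coact : (Coalgebra.counit (R := K) (A := D)).rTensor M ∘ₗ coact = TensorProduct.mk K K M 1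

/-- A right comodule structure on `M` over the `K`-coalgebra `E`: a coaction `M → M ⊗ E` that is
coassociative and counital. -/
structure RightComodule (K M E : Type*) [Field K] [AddCommGroup M] [Module K M]
    [AddCommGroup E] [Module K E] [Coalgebra K E] where
  coact : M →ₗ[K] M ⊗[K] E
  coassoc : TensorProduct.assoc K M E E ∘ₗ coact.rTensor E ∘ₗ coact
    = (Coalgebra.comul (R := K) (A := E)).lTensor M ∘ₗ coact
  counit_coact : (Coalgebra.counit (R := K) (A := E)).lTensor M ∘ₗ coact
    = (TensorProduct.mk K M K).flip 1

/-- A `D`-`E`-bicomodule structure on `M`: a left `D`-coaction and a right `E`-coaction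
that commute with each other. -/
structure Bicomodule (K D M E : Type*) [Field K] [AddCommGroup D] [Module K D] [Coalgebra K D]
    [AddCommGroup M] [Module K M] [AddCommGroup E] [Module K E] [Coalgebra K E] where
  left : LeftComodule K D M
  right : RightComodule K M E
  compat : TensorProduct.assoc K D M E ∘ₗ left.coact.rTensor E ∘ₗ right.coact
    = right.coact.lTensor D ∘ₗ left.coact

namespace LeftComodule

variable {K D M N : Type*} [Field K] [AddCommGroup D] [Module K D] [Coalgebra K D]
  [AddCommGroup M] [Module K M] [AddCommGroup N] [Module K N]

/-- The subspace `X` is a subcomodule: the coaction maps `X` into `D ⊗ X`. -/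
def IsSubcomodule (P : LeftComodule K D M) (X : Submodule K M) : Prop :=
  ∀ x ∈ X, P.coact x ∈ LinearMap.range (X.subtype.lTensor D)

/-- Descending chain condition on subcomodules. -/
def IsArtinian (P : LeftComodule K D M) : Prop :=
  WellFoundedLT {X : Submodule K M // P.IsSubcomodule X}

/-- `f` is a morphism of left `D`-comodules. -/
def IsHom (P : LeftComodule K D M) (Q : LeftComodule K D N) (f : M →ₗ[K] N) : Prop :=
  Q.coact ∘ₗ f = f.lTensor D ∘ₗ P.coact

/-- `D` as a left comodule over itself. -/
def regular (K D : Type*) [Field K] [AddCommGroup D] [Module K D] [Coalgebra K D] :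
    LeftComodule K D D where
  coact := Coalgebra.comul
  coassoc := Coalgebra.coassoc
  counit_coact := Coalgebra.rTensor_counit_comp_comul

/-- The direct sum of `n` copies of a left comodule. -/
def power (P : LeftComodule K D M) (n : ℕ) : LeftComodule K D (Fin n → M) where
  coact := ∑ i, (LinearMap.single K (fun _ : Fin n => M) i).lTensor D ∘ₗ P.coact ∘ₗ LinearMap.proj i
  coassoc := by
    refine LinearMap.pi_ext' fun j => LinearMap.ext fun m => ?_
    have h := congrArg (((LinearMap.single K (fun _ : Fin n => M) j).lTensor D).lTensor D)
      (LinearMap.congr_fun P.coassoc m)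
    have key : (∑ i, (LinearMap.single K (fun _ : Fin n => M) i).lTensor D ∘ₗ P.coact ∘ₗ
        LinearMap.proj i) ∘ₗ LinearMap.single K (fun _ : Fin n => M) j
        = (LinearMap.single K (fun _ : Fin n => M) j).lTensor D ∘ₗ P.coact := by
      ext x
      simp only [LinearMap.comp_apply, LinearMap.sum_apply, LinearMap.proj_apply]
      rw [Finset.sum_eq_single j] <;> simp +contextual [Pi.single_eq_of_ne]
    have key' := LinearMap.congr_fun key m
    simp only [LinearMap.comp_apply] at key' h ⊢
    rw [key', ← LinearMap.comp_apply (LinearMap.lTensor D (Finset.sum _ _)),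
      ← LinearMap.lTensor_comp, key, LinearMap.lTensor_comp, LinearMap.comp_apply, ← h]
    generalize P.coact m = t
    induction t with
    | zero => simp
    | add x y hx hy => simp only [map_add, hx, hy]
    | tmul d x =>
      simp only [LinearMap.lTensor_tmul, LinearMap.rTensor_tmul]
      generalize Coalgebra.comul (R := K) d = u
      induction u with
      | zero => simp
      | add x y hx hy => simp only [map_add, TensorProduct.add_tmul, hx, hy]
      | tmul a b => simp
  counit_coact := by
    refine LinearMap.pi_ext' fun j => LinearMap.ext fun m => ?_
    have h := congrArg ((LinearMap.single K (fun _ : Fin n => M) j).lTensor K)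
      (LinearMap.congr_fun P.counit_coact m)
    simp only [LinearMap.comp_apply, LinearMap.sum_apply, LinearMap.proj_apply] at h ⊢
    rw [Finset.sum_eq_single j (by simp +contextual [Pi.single_eq_of_ne]) (by simp)]
    simp only [LinearMap.single_apply, Pi.single_eq_same]
    rw [← LinearMap.comp_apply, LinearMap.rTensor_comp_lTensor, ← LinearMap.lTensor_comp_rTensor,
      LinearMap.comp_apply, h]
    simp

/-- The comodule embeds in `Dⁿ` for some positive integer `n`. -/
def IsFinitelyCogenerated (P : LeftComodule K D M) : Prop :=
  ∃ n : ℕ, 0 < n ∧ ∃ f : M →ₗ[K] (Fin n → D),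
    P.IsHom ((regular K D).power n) f ∧ Function.Injective f

/-- A left `D`-comodule as a `D`-`K`-bicomodule, with the right `K`-coaction `m ↦ m ⊗ 1` that every
vector space has. -/
def toBicomodule (P : LeftComodule K D M) : Bicomodule K D M K where
  left := P
  right :=
    { coact := (TensorProduct.mk K M K).flip 1
      coassoc := by
        ext m; simp
      counit_coact := by
        ext m; simp }
  compat := by
    ext m
    simp only [LinearMap.comp_apply, LinearEquiv.coe_coe, LinearMap.flip_apply,
      TensorProduct.mk_apply, LinearMap.rTensor_tmul]
    generalize P.coact m = t
    induction t with
    | zero => simp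
    | add x y hx hy => simp only [map_add, TensorProduct.add_tmul, hx, hy]
    | tmul a b => simp

end LeftComodule

namespace RightComodule

variable {K E M N : Type*} [Field K] [AddCommGroup E] [Module K E] [Coalgebra K E]
  [AddCommGroup M] [Module K M] [AddCommGroup N] [Module K N]

/-- The subspace `X` is a subcomodule: the coaction maps `X` into `X ⊗ E`. -/
def IsSubcomodule (P : RightComodule K M E) (X : Submodule K M) : Prop :=
  ∀ x ∈ X, P.coact x ∈ LinearMap.range (X.subtype.rTensor E)

/-- Descending chain condition on subcomodules. -/
def IsArtinian (P : RightComodule K M E) : Prop :=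
  WellFoundedLT {X : Submodule K M // P.IsSubcomodule X}

/-- `f` is a morphism of right `E`-comodules. -/
def IsHom (P : RightComodule K M E) (Q : RightComodule K N E) (f : M →ₗ[K] N) : Prop :=
  Q.coact ∘ₗ f = f.rTensor E ∘ₗ P.coact

/-- `E` as a right comodule over itself. -/
def regular (K E : Type*) [Field K] [AddCommGroup E] [Module K E] [Coalgebra K E] :
    RightComodule K E E where
  coact := Coalgebra.comul
  coassoc := Coalgebra.coassoc
  counit_coact := Coalgebra.lTensor_counit_comp_comul

/-- The direct sum of `n` copies of a right comodule. -/
def power (P : RightComodule K M E) (n : ℕ) : RightComodule K (Fin n → M) E where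
  coact := ∑ i, (LinearMap.single K (fun _ : Fin n => M) i).rTensor E ∘ₗ P.coact ∘ₗ LinearMap.proj i
  coassoc := by
    refine LinearMap.pi_ext' fun j => LinearMap.ext fun m => ?_
    have h := congrArg ((LinearMap.single K (fun _ : Fin n => M) j).rTensor (E ⊗[K] E))
      (LinearMap.congr_fun P.coassoc m)
    have key : (∑ i, (LinearMap.single K (fun _ : Fin n => M) i).rTensor E ∘ₗ P.coact ∘ₗ
        LinearMap.proj i) ∘ₗ LinearMap.single K (fun _ : Fin n => M) j
        = (LinearMap.single K (fun _ : Fin n => M) j).rTensor E ∘ₗ P.coact := by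
      ext x
      simp only [LinearMap.comp_apply, LinearMap.sum_apply, LinearMap.proj_apply]
      rw [Finset.sum_eq_single j] <;> simp +contextual [Pi.single_eq_of_ne]
    have key' := LinearMap.congr_fun key m
    simp only [LinearMap.comp_apply] at key' h ⊢
    rw [key', ← LinearMap.comp_apply (LinearMap.rTensor E (Finset.sum _ _)),
      ← LinearMap.rTensor_comp, key, LinearMap.rTensor_comp, LinearMap.comp_apply,
      ← LinearMap.comp_apply (LinearMap.lTensor _ _), LinearMap.lTensor_comp_rTensor,
      ← LinearMap.rTensor_comp_lTensor, LinearMap.comp_apply, ← h]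
    generalize LinearMap.rTensor E P.coact (P.coact m) = t
    induction t with
    | zero => simp
    | add x y hx hy => simp only [map_add, hx, hy]
    | tmul u e =>
      induction u with
      | zero => simp
      | add x y hx hy => simp only [map_add, TensorProduct.add_tmul, hx, hy]
      | tmul a b => simp
  counit_coact := by
    refine LinearMap.pi_ext' fun j => LinearMap.ext fun m => ?_
    have h := congrArg ((LinearMap.single K (fun _ : Fin n => M) j).rTensor K)
      (LinearMap.congr_fun P.counit_coact m)
    simp only [LinearMap.comp_apply, LinearMap.sum_apply, LinearMap.proj_apply] at h ⊢
    rw [Finset.sum_eq_single j (by simp +contextual [Pi.single_eq_of_ne]) (by simp)]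
    simp only [LinearMap.single_apply, Pi.single_eq_same]
    rw [← LinearMap.comp_apply, LinearMap.lTensor_comp_rTensor, ← LinearMap.rTensor_comp_lTensor,
      LinearMap.comp_apply, h]
    simp

/-- The comodule embeds in `Eⁿ` for some positive integer `n`. -/
def IsFinitelyCogenerated (P : RightComodule K M E) : Prop :=
  ∃ n : ℕ, 0 < n ∧ ∃ f : M →ₗ[K] (Fin n → E),
    P.IsHom ((regular K E).power n) f ∧ Function.Injective f

end RightComodule

/-- A coalgebra is left Artinian if it is Artinian as a left comodule over itself. -/
def IsLeftArtinianCoalgebra (K C : Type*) [Field K] [AddCommGroup C] [Module K C]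
    [Coalgebra K C] : Prop :=
  (LeftComodule.regular K C).IsArtinian

/-- A coalgebra is right Artinian if it is Artinian as a right comodule over itself. -/
def IsRightArtinianCoalgebra (K C : Type*) [Field K] [AddCommGroup C] [Module K C]
    [Coalgebra K C] : Prop :=
  (RightComodule.regular K C).IsArtinian

/-- The underlying space `D ⊕ M ⊕ E` of the upper triangular comatrix coalgebra `(D M; 0 E)`
of a `D`-`E`-bicomodule `M`. -/
def TriangularComatrix {K D M E : Type*} [Field K] [AddCommGroup D] [Module K D] [Coalgebra K D]
    [AddCommGroup M] [Module K M] [AddCommGroup E] [Module K E] [Coalgebra K E]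
    (_B : Bicomodule K D M E) : Type _ :=
  D × M × E

namespace TriangularComatrix

variable {K D M E : Type*} [Field K] [AddCommGroup D] [Module K D] [Coalgebra K D]
  [AddCommGroup M] [Module K M] [AddCommGroup E] [Module K E] [Coalgebra K E]
  (B : Bicomodule K D M E)

instance : AddCommGroup (TriangularComatrix B) := inferInstanceAs (AddCommGroup (D × M × E))

instance : Module K (TriangularComatrix B) := inferInstanceAs (Module K (D × M × E))

/-- The inclusion `d ↦ (d 0; 0 0)`. -/
def inD : D →ₗ[K] TriangularComatrix B := LinearMap.inl K D (M × E)

/-- The inclusion `m ↦ (0 m; 0 0)`. -/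
def inM : M →ₗ[K] TriangularComatrix B := LinearMap.inr K D (M × E) ∘ₗ LinearMap.inl K M E

/-- The inclusion `e ↦ (0 0; 0 e)`. -/
def inE : E →ₗ[K] TriangularComatrix B := LinearMap.inr K D (M × E) ∘ₗ LinearMap.inr K M E

/-- The linear map on `(D M; 0 E)` with the given restrictions to `D`, `M` and `E`. -/
def desc {V : Type*} [AddCommGroup V] [Module K V] (f : D →ₗ[K] V) (g : M →ₗ[K] V)
    (h : E →ₗ[K] V) : TriangularComatrix B →ₗ[K] V :=
  LinearMap.coprod f (LinearMap.coprod g h)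

section

variable {V : Type*} [AddCommGroup V] [Module K V] (f : D →ₗ[K] V) (g : M →ₗ[K] V) (h : E →ₗ[K] V)

theorem desc_inD : desc B f g h ∘ₗ inD B = f := by
  ext x; change f x + (g 0 + h 0) = f x; simp

theorem desc_inM : desc B f g h ∘ₗ inM B = g := by
  ext x; change f 0 + (g x + h 0) = g x; simp

theorem desc_inE : desc B f g h ∘ₗ inE B = h := by
  ext x; change f 0 + (g 0 + h x) = h x; simp

theorem hom_ext {p q : TriangularComatrix B →ₗ[K] V} (h₁ : p ∘ₗ inD B = q ∘ₗ inD B)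
    (h₂ : p ∘ₗ inM B = q ∘ₗ inM B) (h₃ : p ∘ₗ inE B = q ∘ₗ inE B) : p = q :=
  LinearMap.prod_ext h₁ (LinearMap.prod_ext h₂ h₃)

end

/-- `Δ d = d₁ ⊗ d₂`, `Δ m = m₍₋₁₎ ⊗ m₍₀₎ + m₍₀₎ ⊗ m₍₁₎`, `Δ e = e₁ ⊗ e₂`;
`ε (d m; 0 e) = ε d + ε e`. -/
noncomputable instance : CoalgebraStruct K (TriangularComatrix B) where
  comul := desc B
    (TensorProduct.map (inD B) (inD B) ∘ₗ Coalgebra.comul)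
    (TensorProduct.map (inD B) (inM B) ∘ₗ B.left.coact
      + TensorProduct.map (inM B) (inE B) ∘ₗ B.right.coact)
    (TensorProduct.map (inE B) (inE B) ∘ₗ Coalgebra.comul)
  counit := desc B Coalgebra.counit 0 Coalgebra.counit

theorem comul_inD (d : D) : Coalgebra.comul (R := K) (inD B d)
    = TensorProduct.map (inD B) (inD B) (Coalgebra.comul d) :=
  LinearMap.congr_fun (desc_inD B _ _ _) d

theorem comul_inM (m : M) : Coalgebra.comul (R := K) (inM B m)
    = TensorProduct.map (inD B) (inM B) (B.left.coact m)
      + TensorProduct.map (inM B) (inE B) (B.right.coact m) :=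
  LinearMap.congr_fun (desc_inM B _ _ _) m

theorem comul_inE (e : E) : Coalgebra.comul (R := K) (inE B e)
    = TensorProduct.map (inE B) (inE B) (Coalgebra.comul e) :=
  LinearMap.congr_fun (desc_inE B _ _ _) e

theorem counit_inD (d : D) : Coalgebra.counit (R := K) (inD B d) = Coalgebra.counit (R := K) d :=
  LinearMap.congr_fun (desc_inD B _ _ _) d

theorem counit_inM (m : M) : Coalgebra.counit (R := K) (inM B m) = 0 :=
  LinearMap.congr_fun (desc_inM B _ _ _) m

theorem counit_inE (e : E) : Coalgebra.counit (R := K) (inE B e) = Coalgebra.counit (R := K) e :=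
  LinearMap.congr_fun (desc_inE B _ _ _) e

theorem comul_comp_inD : Coalgebra.comul ∘ₗ inD B
    = TensorProduct.map (inD B) (inD B) ∘ₗ Coalgebra.comul := desc_inD B _ _ _

theorem comul_comp_inM : Coalgebra.comul ∘ₗ inM B
    = TensorProduct.map (inD B) (inM B) ∘ₗ B.left.coact
      + TensorProduct.map (inM B) (inE B) ∘ₗ B.right.coact := desc_inM B _ _ _

theorem comul_comp_inE : Coalgebra.comul ∘ₗ inE B
    = TensorProduct.map (inE B) (inE B) ∘ₗ Coalgebra.comul := desc_inE B _ _ _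

theorem counit_comp_inD : Coalgebra.counit ∘ₗ inD B = Coalgebra.counit (R := K) :=
  desc_inD B _ _ _

theorem counit_comp_inM : Coalgebra.counit ∘ₗ inM B = (0 : M →ₗ[K] K) := desc_inM B _ _ _

theorem counit_comp_inE : Coalgebra.counit ∘ₗ inE B = Coalgebra.counit (R := K) :=
  desc_inE B _ _ _

section

variable {S T U V W X : Type*} [AddCommGroup S] [Module K S] [AddCommGroup T] [Module K T]
  [AddCommGroup U] [Module K U] [AddCommGroup V] [Module K V] [AddCommGroup W] [Module K W]
  [AddCommGroup X] [Module K X]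

theorem assoc_map_aux (f : S →ₗ[K] V) (g : T →ₗ[K] V) (h : U →ₗ[K] V) (p : W →ₗ[K] S ⊗[K] T)
    (t : W ⊗[K] U) :
    TensorProduct.assoc K V V V (TensorProduct.map (TensorProduct.map f g ∘ₗ p) h t)
      = TensorProduct.map f (TensorProduct.map g h)
          (TensorProduct.assoc K S T U (p.rTensor U t)) := by
  induction t with
  | zero => simp
  | add x y hx hy => simp only [map_add, hx, hy]
  | tmul w u =>
    simp only [TensorProduct.map_tmul, LinearMap.comp_apply, LinearMap.rTensor_tmul]
    generalize p w = r
    induction r with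
    | zero => simp
    | add x y hx hy => simp only [map_add, TensorProduct.add_tmul, hx, hy]
    | tmul a b => simp

theorem map_comp_aux (f : S →ₗ[K] V) (g : T →ₗ[K] V) (h : U →ₗ[K] V) (p : W →ₗ[K] T ⊗[K] U)
    (t : S ⊗[K] W) :
    TensorProduct.map f (TensorProduct.map g h ∘ₗ p) t
      = TensorProduct.map f (TensorProduct.map g h) (p.lTensor S t) := by
  rw [← LinearMap.comp_apply (TensorProduct.map f _), LinearMap.map_comp_lTensor]

theorem map_counit_left_aux (p : W →ₗ[K] K) (g : T →ₗ[K] V) (t : W ⊗[K] T) :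
    TensorProduct.map p g t = g.lTensor K (p.rTensor T t) := by
  rw [← LinearMap.comp_apply, LinearMap.lTensor_comp_rTensor]

theorem map_counit_right_aux (p : W →ₗ[K] K) (g : T →ₗ[K] V) (t : T ⊗[K] W) :
    TensorProduct.map g p t = g.rTensor K (p.lTensor T t) := by
  rw [← LinearMap.comp_apply, LinearMap.rTensor_comp_lTensor]

end

noncomputable instance : Coalgebra K (TriangularComatrix B) where
  coassoc := by
    apply hom_ext B <;> ext x <;> simp only [LinearMap.comp_apply, LinearEquiv.coe_coe]
    · rw [comul_inD, LinearMap.rTensor_map, LinearMap.lTensor_map, comul_comp_inD, assoc_map_aux,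
        map_comp_aux, Coalgebra.coassoc_apply]
    · have h₁ := LinearMap.congr_fun B.left.coassoc x
      have h₂ := LinearMap.congr_fun B.right.coassoc x
      have h₃ := LinearMap.congr_fun B.compat x
      simp only [LinearMap.comp_apply, LinearEquiv.coe_coe] at h₁ h₂ h₃
      rw [comul_inM]
      simp only [map_add, LinearMap.rTensor_map, LinearMap.lTensor_map]
      rw [comul_comp_inD, comul_comp_inM, comul_comp_inE, TensorProduct.map_add_left,
        TensorProduct.map_add_right]
      simp only [LinearMap.add_apply, map_add, assoc_map_aux, map_comp_aux, h₁, h₂, h₃]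
      abel
    · rw [comul_inE, LinearMap.rTensor_map, LinearMap.lTensor_map, comul_comp_inE, assoc_map_aux,
        map_comp_aux, Coalgebra.coassoc_apply]
  rTensor_counit_comp_comul := by
    apply hom_ext B <;> ext x <;> simp only [LinearMap.comp_apply]
    · rw [comul_inD, LinearMap.rTensor_map, counit_comp_inD, map_counit_left_aux]
      simp
    · have h := LinearMap.congr_fun B.left.counit_coact x
      simp only [LinearMap.comp_apply] at h
      rw [comul_inM, map_add, LinearMap.rTensor_map, LinearMap.rTensor_map, counit_comp_inD,
        counit_comp_inM, map_counit_left_aux, h]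
      simp
    · rw [comul_inE, LinearMap.rTensor_map, counit_comp_inE, map_counit_left_aux]
      simp
  lTensor_counit_comp_comul := by
    apply hom_ext B <;> ext x <;> simp only [LinearMap.comp_apply]
    · rw [comul_inD, LinearMap.lTensor_map, counit_comp_inD, map_counit_right_aux]
      simp
    · have h := LinearMap.congr_fun B.right.counit_coact x
      simp only [LinearMap.comp_apply] at h
      rw [comul_inM, map_add, LinearMap.lTensor_map, LinearMap.lTensor_map, counit_comp_inE,
        counit_comp_inM, map_counit_right_aux, map_counit_right_aux, h]
      simp
    · rw [comul_inE, LinearMap.lTensor_map, counit_comp_inE, map_counit_right_aux]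
      simp

end TriangularComatrix

/-- The underlying space of the divided power coalgebra, with basis `c₀, c₁, c₂, …`. -/
def DividedPowerCoalgebra (K : Type*) [Field K] : Type _ := ℕ →₀ K

namespace DividedPowerCoalgebra

variable (K : Type*) [Field K]

noncomputable instance : AddCommGroup (DividedPowerCoalgebra K) :=
  inferInstanceAs (AddCommGroup (ℕ →₀ K))

noncomputable instance : Module K (DividedPowerCoalgebra K) := inferInstanceAs (Module K (ℕ →₀ K))

/-- The basis `c₀, c₁, c₂, …`. -/
noncomputable def basis : Module.Basis ℕ K (DividedPowerCoalgebra K) :=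
  Module.Basis.ofRepr (LinearEquiv.refl K (ℕ →₀ K))

/-- `Δ cₙ = ∑_{i + j = n} cᵢ ⊗ cⱼ`; `ε c₀ = 1` and `ε cₙ = 0` for `n > 0`. -/
noncomputable instance : CoalgebraStruct K (DividedPowerCoalgebra K) where
  comul := (basis K).constr K
    (fun n => ∑ p ∈ Finset.HasAntidiagonal.antidiagonal n, basis K p.1 ⊗ₜ[K] basis K p.2)
  counit := (basis K).constr K (fun n => if n = 0 then (1 : K) else 0)

theorem comul_basis (n : ℕ) : Coalgebra.comul (R := K) (basis K n)
    = ∑ p ∈ Finset.HasAntidiagonal.antidiagonal n, basis K p.1 ⊗ₜ[K] basis K p.2 :=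
  (basis K).constr_basis K _ n

theorem counit_basis (n : ℕ) : Coalgebra.counit (R := K) (basis K n) = if n = 0 then (1 : K) else 0 :=
  (basis K).constr_basis K _ n

noncomputable instance : Coalgebra K (DividedPowerCoalgebra K) where
  coassoc := by
    refine (basis K).ext fun n => ?_
    simp only [LinearMap.comp_apply, LinearEquiv.coe_coe, comul_basis, map_sum,
      LinearMap.rTensor_tmul, LinearMap.lTensor_tmul, TensorProduct.sum_tmul,
      TensorProduct.tmul_sum, TensorProduct.assoc_tmul]
    rw [Finset.sum_sigma', Finset.sum_sigma']
    refine Finset.sum_nbij' (fun p => ⟨(p.2.1, p.2.2 + p.1.2), (p.2.2, p.1.2)⟩)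
      (fun p => ⟨(p.1.1 + p.2.1, p.2.2), (p.1.1, p.2.1)⟩) ?_ ?_ ?_ ?_ ?_
    · rintro ⟨⟨a, b⟩, c, d⟩ h
      simp only [Finset.mem_sigma, Finset.HasAntidiagonal.mem_antidiagonal] at h ⊢
      obtain ⟨h₁, h₂⟩ := h
      exact ⟨by omega, trivial⟩
    · rintro ⟨⟨a, b⟩, c, d⟩ h
      simp only [Finset.mem_sigma, Finset.HasAntidiagonal.mem_antidiagonal] at h ⊢
      obtain ⟨h₁, h₂⟩ := h
      exact ⟨by omega, trivial⟩
    · rintro ⟨⟨a, b⟩, c, d⟩ h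
      simp only [Finset.mem_sigma, Finset.HasAntidiagonal.mem_antidiagonal] at h
      obtain ⟨_, rfl⟩ := h
      rfl
    · rintro ⟨⟨a, b⟩, c, d⟩ h
      simp only [Finset.mem_sigma, Finset.HasAntidiagonal.mem_antidiagonal] at h
      obtain ⟨_, rfl⟩ := h
      rfl
    · rintro ⟨⟨a, b⟩, c, d⟩ h
      rfl
  rTensor_counit_comp_comul := by
    refine (basis K).ext fun n => ?_
    simp only [LinearMap.comp_apply, comul_basis, map_sum, LinearMap.rTensor_tmul, counit_basis,
      TensorProduct.mk_apply]
    rw [Finset.sum_eq_single (0, n)]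
    · simp
    · rintro ⟨a, b⟩ h hne
      have : a ≠ 0 := by
        rintro rfl
        simp_all
      simp [this]
    · simp
  lTensor_counit_comp_comul := by
    refine (basis K).ext fun n => ?_
    simp only [LinearMap.comp_apply, comul_basis, map_sum, LinearMap.lTensor_tmul, counit_basis,
      LinearMap.flip_apply, TensorProduct.mk_apply]
    rw [Finset.sum_eq_single (n, 0)]
    · simp
    · rintro ⟨a, b⟩ h hne
      have : b ≠ 0 := by
        rintro rfl
        simp_all
      simp [this]
    · simp

end DividedPowerCoalgebra

/-! A right `C`-comodule is a left module over the convolution algebra `C*` of functionals, through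
`u • m = m₍₀₎ u(m₍₁₎)`, and its subcomodules are exactly its submodules. Hence the theory of
Artinian modules applies. The coefficient maps `m ↦ u(m₍₀₎) m₍₁₎`, for `u` a functional on a
comodule `M`, are comodule morphisms `M → C` that together separate points, so if `M` is Artinian
then finitely many of them already embed it in `Cⁿ`. Over a right Artinian `C`, Artinian and
finitely cogenerated right comodules therefore coincide.

For the triangular comatrix coalgebra `T`, the inclusion of `D` and the projections fit into an
exact sequence `0 → D → T → M ⊕ E → 0` of right `T`-comodules, where the coaction of each corner is
extended along an injection of coalgebras into `T`, which does not change its subcomodules. The left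
criterion is the right one for the co-opposite coalgebras, because reflection in the antidiagonal
identifies `Tᶜᵒᵖ` with the comatrix coalgebra of `Eᶜᵒᵖ`, `M`, `Dᶜᵒᵖ`.

In the divided power coalgebra the functional dual to `cₖ` acts by `cₙ ↦ cₙ₋ₖ`, so a subcomodule
containing an element of degree `N` contains `c₀, …, c_N`, and every proper subcomodule is finite
dimensional.
-/

section Slice

variable {K V V' W W' : Type*} [Field K] [AddCommGroup V] [Module K V] [AddCommGroup V']
  [Module K V'] [AddCommGroup W] [Module K W] [AddCommGroup W'] [Module K W']

/-- The slice map `id ⊗ u : V ⊗ W → V` of a functional `u` on the second factor. -/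
noncomputable def rightSlice (V : Type*) [AddCommGroup V] [Module K V] (u : W →ₗ[K] K) :
    V ⊗[K] W →ₗ[K] V :=
  TensorProduct.rid K V ∘ₗ u.lTensor V

@[simp]
theorem rightSlice_tmul (u : W →ₗ[K] K) (v : V) (w : W) : rightSlice V u (v ⊗ₜ w) = u w • v := by
  simp [rightSlice]

theorem rightSlice_rTensor (u : W →ₗ[K] K) (f : V →ₗ[K] V') (t : V ⊗[K] W) :
    rightSlice V' u (f.rTensor W t) = f (rightSlice V u t) := by
  induction t with
  | zero => simp
  | add x y hx hy => simp only [map_add, hx, hy]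
  | tmul v w => simp

theorem rightSlice_lTensor (u : W' →ₗ[K] K) (g : W →ₗ[K] W') (t : V ⊗[K] W) :
    rightSlice V u (g.lTensor V t) = rightSlice V (u ∘ₗ g) t := by
  simp [rightSlice, LinearMap.lTensor_comp]

theorem equivFinsuppOfBasisRight_apply_eq_rightSlice {ι : Type*} [DecidableEq ι]
    (b : Module.Basis ι K W) (t : V ⊗[K] W) (i : ι) :
    TensorProduct.equivFinsuppOfBasisRight b t i = rightSlice V (b.coord i) t := by
  induction t with
  | zero => simp
  | add x y hx hy => simp only [map_add, Finsupp.add_apply, hx, hy]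
  | tmul v w => simp

theorem eq_zero_of_forall_rightSlice_eq_zero {t : V ⊗[K] W}
    (h : ∀ u : W →ₗ[K] K, rightSlice V u t = 0) : t = 0 := by
  classical
  refine (TensorProduct.equivFinsuppOfBasisRight
    (Module.Basis.ofVectorSpace K W)).map_eq_zero_iff.mp (Finsupp.ext fun i => ?_)
  rw [equivFinsuppOfBasisRight_apply_eq_rightSlice, h, Finsupp.zero_apply]

theorem mem_range_rTensor_subtype_iff {X : Submodule K V} {t : V ⊗[K] W} :
    t ∈ LinearMap.range (X.subtype.rTensor W) ↔ ∀ u : W →ₗ[K] K, rightSlice V u t ∈ X := by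
  constructor
  · rintro ⟨s, rfl⟩ u
    rw [rightSlice_rTensor]
    exact (rightSlice X u s).2
  · intro h
    rw [← (rTensor_exact W (LinearMap.exact_subtype_mkQ X) X.mkQ_surjective).linearMap_ker_eq,
      LinearMap.mem_ker]
    refine eq_zero_of_forall_rightSlice_eq_zero fun u => ?_
    rw [rightSlice_rTensor]
    simpa using h u

/-- The slice map `u ⊗ id : V ⊗ W → W` of a functional `u` on the first factor. -/
noncomputable def leftSlice (W : Type*) [AddCommGroup W] [Module K W] (u : V →ₗ[K] K) :
    V ⊗[K] W →ₗ[K] W :=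
  TensorProduct.lid K W ∘ₗ u.rTensor W

@[simp]
theorem leftSlice_tmul (u : V →ₗ[K] K) (v : V) (w : W) : leftSlice W u (v ⊗ₜ w) = u v • w := by
  simp [leftSlice]

theorem leftSlice_comp_lTensor (u : V →ₗ[K] K) (g : W →ₗ[K] W') :
    leftSlice W' u ∘ₗ g.lTensor V = g ∘ₗ leftSlice W u := by
  ext v w
  simp

theorem leftSlice_comp_assoc (u : V →ₗ[K] K) :
    leftSlice (W ⊗[K] W') u ∘ₗ TensorProduct.assoc K V W W' = (leftSlice W u).rTensor W' := by
  ext v w w'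
  simp [TensorProduct.smul_tmul']

end Slice

namespace RightComodule

section Action

variable {K E M N : Type*} [Field K] [AddCommGroup E] [Module K E] [Coalgebra K E]
  [AddCommGroup M] [Module K M] [AddCommGroup N] [Module K N]
  (P : RightComodule K M E) {Q : RightComodule K N E}

/-- The operator `m ↦ m₍₀₎ u(m₍₁₎)` of a functional `u` on a right comodule. -/
noncomputable def act (u : E →ₗ[K] K) : M →ₗ[K] M :=
  rightSlice M u ∘ₗ P.coact

theorem act_apply (u : E →ₗ[K] K) (m : M) : P.act u m = rightSlice M u (P.coact m) := rfl

theorem isSubcomodule_iff_forall_act_mem {X : Submodule K M} :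
    P.IsSubcomodule X ↔ ∀ u, ∀ x ∈ X, P.act u x ∈ X := by
  simp only [IsSubcomodule, mem_range_rTensor_subtype_iff, act_apply]
  exact ⟨fun h u x hx => h x hx u, fun h x hx u => h u x hx⟩

theorem act_zero : P.act 0 = 0 := by
  simp [act, rightSlice]

theorem act_add (u v : E →ₗ[K] K) : P.act (u + v) = P.act u + P.act v := by
  simp [act, rightSlice, LinearMap.lTensor_add, LinearMap.comp_add, LinearMap.add_comp]

theorem act_smul (c : K) (u : E →ₗ[K] K) : P.act (c • u) = c • P.act u := by
  simp [act, rightSlice, LinearMap.lTensor_smul, LinearMap.comp_smul, LinearMap.smul_comp]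

theorem act_convOne : P.act (1 : WithConv (E →ₗ[K] K)).ofConv = LinearMap.id := by
  change TensorProduct.rid K M ∘ₗ Coalgebra.counit.lTensor M ∘ₗ P.coact = LinearMap.id
  rw [P.counit_coact]
  ext m
  simp

theorem act_convMul (u v : WithConv (E →ₗ[K] K)) :
    P.act (u * v).ofConv = P.act u.ofConv ∘ₗ P.act v.ofConv := by
  have slice_assoc (t : M ⊗[K] E) :
      rightSlice M (LinearMap.mul' K K ∘ₗ TensorProduct.map u.ofConv v.ofConv)
        (TensorProduct.assoc K M E E (P.coact.rTensor E t))
        = P.act u.ofConv (rightSlice M v.ofConv t) := by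
    induction t with
    | zero => simp
    | add x y hx hy => simp only [map_add, hx, hy]
    | tmul m e =>
      rw [LinearMap.rTensor_tmul, rightSlice_tmul, map_smul, act_apply]
      induction P.coact m with
      | zero => simp
      | add x y hx hy => simp only [TensorProduct.add_tmul, map_add, smul_add, hx, hy]
      | tmul m' e' => simp [smul_smul, mul_comm]
  ext m
  have h := LinearMap.congr_fun P.coassoc m
  simp only [LinearMap.comp_apply, LinearEquiv.coe_coe] at h
  rw [LinearMap.comp_apply, act_apply _ v.ofConv, ← slice_assoc, h, rightSlice_lTensor]
  rfl

theorem IsHom.map_act {P : RightComodule K M E} {f : M →ₗ[K] N} (h : P.IsHom Q f)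
    (u : E →ₗ[K] K) (m : M) : f (P.act u m) = Q.act u (f m) := by
  rw [act_apply, act_apply, ← LinearMap.comp_apply Q.coact, h, LinearMap.comp_apply,
    rightSlice_rTensor]

/-- The underlying space of a right comodule as a left module over the convolution algebra of
functionals on the coalgebra, `u • m = m₍₀₎ u(m₍₁₎)`. Its submodules are the subcomodules. -/
def RationalModule (_P : RightComodule K M E) : Type _ := M

instance : AddCommGroup P.RationalModule := inferInstanceAs (AddCommGroup M)

instance : Module K P.RationalModule := inferInstanceAs (Module K M)

noncomputable instance : Module (WithConv (E →ₗ[K] K)) P.RationalModule where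
  smul u m := P.act u.ofConv m
  one_smul m := LinearMap.congr_fun P.act_convOne m
  mul_smul u v m := LinearMap.congr_fun (P.act_convMul u v) m
  smul_zero u := map_zero (P.act u.ofConv)
  smul_add u := map_add (P.act u.ofConv)
  add_smul u v m := LinearMap.congr_fun (P.act_add u.ofConv v.ofConv) m
  zero_smul m := LinearMap.congr_fun P.act_zero m

theorem RationalModule.algebraMap_smul (c : K) (m : P.RationalModule) :
    algebraMap K (WithConv (E →ₗ[K] K)) c • m = c • m := by
  rw [Algebra.algebraMap_eq_smul_one]
  exact (LinearMap.congr_fun (P.act_smul c (1 : WithConv (E →ₗ[K] K)).ofConv) m).trans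
    (congrArg (c • ·) (LinearMap.congr_fun P.act_convOne m))

/-- Subcomodules are the same as submodules of the rational module. -/
def subcomoduleEquiv : {X : Submodule K M // P.IsSubcomodule X} ≃o
    Submodule (WithConv (E →ₗ[K] K)) P.RationalModule where
  toFun X :=
    { carrier := (X.1 : Set M)
      add_mem' := X.1.add_mem
      zero_mem' := X.1.zero_mem
      smul_mem' := fun u x hx => P.isSubcomodule_iff_forall_act_mem.mp X.2 u.ofConv x hx }
  invFun Y :=
    ⟨{ carrier := (Y : Set P.RationalModule)
       add_mem' := Y.add_mem
       zero_mem' := Y.zero_mem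
       smul_mem' := fun c x hx => RationalModule.algebraMap_smul P c x ▸ Y.smul_mem _ hx },
      P.isSubcomodule_iff_forall_act_mem.mpr fun u _ hx => Y.smul_mem (WithConv.toConv u) hx⟩
  map_rel_iff' := Iff.rfl

theorem isArtinian_iff_isArtinian_rationalModule :
    P.IsArtinian ↔ _root_.IsArtinian (WithConv (E →ₗ[K] K)) P.RationalModule :=
  ⟨fun (_ : WellFoundedLT _) => P.subcomoduleEquiv.symm.strictMono.wellFoundedLT,
    fun _ => P.subcomoduleEquiv.strictMono.wellFoundedLT⟩

/-- A comodule morphism as a linear map of rational modules. -/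
def IsHom.toRational {P : RightComodule K M E} {f : M →ₗ[K] N} (h : P.IsHom Q f) :
    P.RationalModule →ₗ[WithConv (E →ₗ[K] K)] Q.RationalModule where
  toFun := f
  map_add' := f.map_add
  map_smul' u := h.map_act u.ofConv

end Action

end RightComodule

theorem exists_injective_pi_fin {R M N ι : Type*} [Ring R] [AddCommGroup M] [Module R M]
    [IsArtinian R M] [AddCommGroup N] [Module R N] [Nonempty ι] (f : ι → M →ₗ[R] N)
    (hf : ∀ m, (∀ i, f i m = 0) → m = 0) :
    ∃ n, 0 < n ∧ ∃ u : Fin n → ι, Function.Injective (LinearMap.pi fun j => f (u j)) := by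
  classical
  obtain ⟨s, hs⟩ := Finset.exists_inf_le fun i => LinearMap.ker (f i)
  let t : Finset ι := insert (Classical.arbitrary ι) s
  refine ⟨t.card, Finset.card_pos.mpr (Finset.insert_nonempty _ _), fun j => t.equivFin.symm j,
    (injective_iff_map_eq_zero _).mpr fun m hm => hf m fun i => ?_⟩
  have h_mem : m ∈ s.inf fun i => LinearMap.ker (f i) := by
    rw [Submodule.mem_finsetInf]
    intro i hi
    simpa using congrFun hm (t.equivFin ⟨i, Finset.mem_insert_of_mem hi⟩)
  exact hs i h_mem

theorem rank_lt_rank_of_lt {K V : Type*} [Field K] [AddCommGroup V] [Module K V]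
    {X Y : Submodule K V} [FiniteDimensional K X] (h : X < Y) :
    Module.rank K X < Module.rank K Y := by
  refine (Submodule.rank_mono h.le).lt_of_ne fun h_eq => h.ne ?_
  have : FiniteDimensional K Y := Module.rank_lt_aleph0_iff.mp (h_eq ▸ Module.rank_lt_aleph0 K X)
  exact Submodule.eq_of_le_of_finrank_eq h.le (congrArg Cardinal.toNat h_eq)

namespace RightComodule

variable {K E E' M N N' : Type*} [Field K] [AddCommGroup E] [Module K E] [Coalgebra K E]
  [AddCommGroup E'] [Module K E'] [Coalgebra K E'] [AddCommGroup M] [Module K M]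
  [AddCommGroup N] [Module K N] [AddCommGroup N'] [Module K N']

theorem IsHom.isArtinian_of_injective {P : RightComodule K M E} {Q : RightComodule K N E}
    {f : M →ₗ[K] N} (h : P.IsHom Q f) (hf : Function.Injective f) (hQ : Q.IsArtinian) :
    P.IsArtinian := by
  rw [isArtinian_iff_isArtinian_rationalModule] at hQ ⊢
  exact _root_.isArtinian_of_injective h.toRational hf

theorem IsHom.isArtinian_of_surjective {P : RightComodule K M E} {Q : RightComodule K N E}
    {f : M →ₗ[K] N} (h : P.IsHom Q f) (hf : Function.Surjective f) (hP : P.IsArtinian) :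
    Q.IsArtinian := by
  rw [isArtinian_iff_isArtinian_rationalModule] at hP ⊢
  exact _root_.isArtinian_of_surjective _ h.toRational hf

theorem isArtinian_iff_of_exact {L : RightComodule K N' E} {P : RightComodule K M E}
    {Q₁ : RightComodule K N E} {N₂ : Type*} [AddCommGroup N₂] [Module K N₂]
    {Q₂ : RightComodule K N₂ E} {i : N' →ₗ[K] M} {p : M →ₗ[K] N} {q : M →ₗ[K] N₂}
    (hi : L.IsHom P i) (hp : P.IsHom Q₁ p) (hq : P.IsHom Q₂ q) (h_inj : Function.Injective i)
    (h_exact : Function.Exact i (p.prod q)) (h_surj : Function.Surjective (p.prod q)) :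
    P.IsArtinian ↔ L.IsArtinian ∧ Q₁.IsArtinian ∧ Q₂.IsArtinian := by
  refine ⟨fun hP => ⟨hi.isArtinian_of_injective h_inj hP,
    hp.isArtinian_of_surjective (Prod.fst_surjective.comp h_surj) hP,
    hq.isArtinian_of_surjective (Prod.snd_surjective.comp h_surj) hP⟩, ?_⟩
  simp only [isArtinian_iff_isArtinian_rationalModule]
  rintro ⟨hL, hQ₁, hQ₂⟩
  exact isArtinian_of_range_eq_ker hi.toRational (hp.toRational.prod hq.toRational)
    (LinearMap.exact_iff (g := hp.toRational.prod hq.toRational)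
      (f := hi.toRational) |>.mp h_exact).symm

theorem isArtinian_of_forall_finiteDimensional {P : RightComodule K M E}
    (h : ∀ X, P.IsSubcomodule X → X ≠ ⊤ → FiniteDimensional K X) : P.IsArtinian :=
  StrictMono.wellFoundedLT (f := fun X => Module.rank K X.1) fun X Y hXY => by
    have := h X.1 X.2 ((Subtype.coe_lt_coe.mpr hXY).trans_le le_top).ne
    exact rank_lt_rank_of_lt hXY

theorem isHom_power_iff {P : RightComodule K M E} {Q : RightComodule K N E} {n : ℕ}
    {f : M →ₗ[K] (Fin n → N)} :
    P.IsHom (Q.power n) f ↔ ∀ i, P.IsHom Q (LinearMap.proj i ∘ₗ f) := by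
  have proj_comp_coact (i : Fin n) : (LinearMap.proj i).rTensor E ∘ₗ (Q.power n).coact
      = Q.coact ∘ₗ LinearMap.proj i := by
    refine LinearMap.ext fun x => ?_
    simp only [power, LinearMap.comp_apply, LinearMap.sum_apply, map_sum,
      ← LinearMap.rTensor_comp_apply]
    rw [Finset.sum_eq_single i (fun j _ hj => by
      simp [LinearMap.proj_comp_single_ne _ _ _ _ hj.symm]) (by simp)]
    simp [LinearMap.proj_comp_single_same]
  have sum_single_rTensor (t : M ⊗[K] E) :
      ∑ i, (LinearMap.single K (fun _ => N) i).rTensor E ((LinearMap.proj i ∘ₗ f).rTensor E t)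
        = f.rTensor E t := by
    induction t with
    | zero => simp
    | add x y hx hy => simp only [map_add, Finset.sum_add_distrib, hx, hy]
    | tmul m e => simp [← TensorProduct.sum_tmul, Finset.univ_sum_single]
  constructor
  · intro h i
    rw [IsHom, ← LinearMap.comp_assoc, ← proj_comp_coact, LinearMap.comp_assoc, h,
      LinearMap.rTensor_comp, LinearMap.comp_assoc]
  · intro h
    refine LinearMap.ext fun m => ?_
    rw [LinearMap.comp_apply, LinearMap.comp_apply, ← sum_single_rTensor]
    simp only [power, LinearMap.sum_apply, LinearMap.comp_apply]
    exact Finset.sum_congr rfl fun i _ => congrArg _ (LinearMap.congr_fun (h i) m)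

/-- The coefficient map `m ↦ u(m₍₀₎) m₍₁₎` of a functional `u` on a right comodule. -/
noncomputable def coeff (P : RightComodule K M E) (u : M →ₗ[K] K) : M →ₗ[K] E :=
  leftSlice E u ∘ₗ P.coact

theorem counit_comp_coeff (P : RightComodule K M E) (u : M →ₗ[K] K) :
    Coalgebra.counit ∘ₗ P.coeff u = u := by
  rw [coeff, ← LinearMap.comp_assoc, ← leftSlice_comp_lTensor, LinearMap.comp_assoc,
    P.counit_coact]
  ext m
  simp

theorem isHom_coeff (P : RightComodule K M E) (u : M →ₗ[K] K) :
    P.IsHom (regular K E) (P.coeff u) :=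
  calc Coalgebra.comul ∘ₗ leftSlice E u ∘ₗ P.coact
    _ = leftSlice (E ⊗[K] E) u ∘ₗ Coalgebra.comul.lTensor M ∘ₗ P.coact := by
      rw [← LinearMap.comp_assoc, ← leftSlice_comp_lTensor, LinearMap.comp_assoc]
    _ = (leftSlice E u).rTensor E ∘ₗ P.coact.rTensor E ∘ₗ P.coact := by
      rw [← P.coassoc, ← leftSlice_comp_assoc, LinearMap.comp_assoc]
    _ = (P.coeff u).rTensor E ∘ₗ P.coact := by
      rw [coeff, LinearMap.rTensor_comp, LinearMap.comp_assoc]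

theorem eq_zero_of_forall_coeff_eq_zero (P : RightComodule K M E) {m : M}
    (h : ∀ u, P.coeff u m = 0) : m = 0 :=
  (Module.forall_dual_apply_eq_zero_iff K m).mp fun u => by
    rw [← LinearMap.congr_fun (P.counit_comp_coeff u) m, LinearMap.comp_apply, h, map_zero]

theorem IsArtinian.isFinitelyCogenerated {P : RightComodule K M E} (h : P.IsArtinian) :
    P.IsFinitelyCogenerated := by
  rw [isArtinian_iff_isArtinian_rationalModule] at h
  obtain ⟨n, hn, u, hu⟩ := exists_injective_pi_fin (fun u => (P.isHom_coeff u).toRational)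
    fun _ => P.eq_zero_of_forall_coeff_eq_zero
  exact ⟨n, hn, LinearMap.pi fun j => P.coeff (u j),
    isHom_power_iff.mpr fun j => P.isHom_coeff (u j), hu⟩

theorem IsFinitelyCogenerated.isArtinian {P : RightComodule K M E} (h : P.IsFinitelyCogenerated)
    (hE : IsRightArtinianCoalgebra K E) : P.IsArtinian := by
  obtain ⟨n, -, f, hf, h_inj⟩ := h
  rw [IsRightArtinianCoalgebra, isArtinian_iff_isArtinian_rationalModule] at hE
  rw [isArtinian_iff_isArtinian_rationalModule]
  exact _root_.isArtinian_of_injective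
    (LinearMap.pi fun i => (isHom_power_iff.mp hf i).toRational) h_inj

theorem isArtinian_iff_isFinitelyCogenerated {P : RightComodule K M E}
    (hE : IsRightArtinianCoalgebra K E) : P.IsArtinian ↔ P.IsFinitelyCogenerated :=
  ⟨IsArtinian.isFinitelyCogenerated, fun h => h.isArtinian hE⟩

/-- The `E'`-comodule obtained from an `E`-comodule by pushing the coaction forward along a
coalgebra morphism `E → E'`. -/
noncomputable def corestrict (P : RightComodule K M E) (φ : E →ₗc[K] E') :
    RightComodule K M E' where
  coact := φ.toLinearMap.lTensor M ∘ₗ P.coact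
  coassoc := by
    have assoc_comp_map : TensorProduct.assoc K M E' E' ∘ₗ
        TensorProduct.map (φ.toLinearMap.lTensor M) φ.toLinearMap
        = (TensorProduct.map φ.toLinearMap φ.toLinearMap).lTensor M ∘ₗ
          TensorProduct.assoc K M E E := by
      ext m e e'
      simp
    calc TensorProduct.assoc K M E' E' ∘ₗ (φ.toLinearMap.lTensor M ∘ₗ P.coact).rTensor E' ∘ₗ
          φ.toLinearMap.lTensor M ∘ₗ P.coact
      _ = (TensorProduct.assoc K M E' E' ∘ₗ
          TensorProduct.map (φ.toLinearMap.lTensor M) φ.toLinearMap) ∘ₗ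
          P.coact.rTensor E ∘ₗ P.coact := by
        rw [← LinearMap.comp_assoc P.coact, LinearMap.rTensor_comp_lTensor,
          ← LinearMap.map_comp_rTensor, LinearMap.comp_assoc, LinearMap.comp_assoc]
      _ = (TensorProduct.map φ.toLinearMap φ.toLinearMap).lTensor M ∘ₗ
          Coalgebra.comul.lTensor M ∘ₗ P.coact := by
        rw [assoc_comp_map, LinearMap.comp_assoc, P.coassoc]
      _ = Coalgebra.comul.lTensor M ∘ₗ φ.toLinearMap.lTensor M ∘ₗ P.coact := by
        rw [← LinearMap.comp_assoc, ← LinearMap.lTensor_comp, φ.map_comp_comul,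
          LinearMap.lTensor_comp, LinearMap.comp_assoc]
  counit_coact := by
    rw [← LinearMap.comp_assoc, ← LinearMap.lTensor_comp, φ.counit_comp, P.counit_coact]

theorem act_corestrict (P : RightComodule K M E) (φ : E →ₗc[K] E') (u : E' →ₗ[K] K) :
    (P.corestrict φ).act u = P.act (u ∘ₗ φ.toLinearMap) :=
  LinearMap.ext fun m => rightSlice_lTensor u _ (P.coact m)

theorem isArtinian_corestrict_iff (P : RightComodule K M E) {φ : E →ₗc[K] E'}
    (hφ : Function.Injective φ) : (P.corestrict φ).IsArtinian ↔ P.IsArtinian := by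
  have isSubcomodule_iff (X : Submodule K M) :
      (P.corestrict φ).IsSubcomodule X ↔ P.IsSubcomodule X := by
    simp only [isSubcomodule_iff_forall_act_mem, act_corestrict]
    exact (LinearMap.dualMap_surjective_of_injective (f := φ.toLinearMap) hφ).forall
      (p := fun u => ∀ x ∈ X, P.act u x ∈ X) |>.symm
  rw [IsArtinian, IsArtinian, funext fun X => propext (isSubcomodule_iff X)]

end RightComodule

section Reversal

variable {K A B C M N S T : Type*} [Field K] [AddCommGroup A] [Module K A] [AddCommGroup B]
  [Module K B] [AddCommGroup C] [Module K C] [AddCommGroup M] [Module K M] [AddCommGroup N]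
  [Module K N] [AddCommGroup S] [Module K S] [AddCommGroup T] [Module K T]

-- This one identity gives coassociativity for `Cop C`, both coassociativities of a comodule and
-- the compatibility of a bicomodule when all tensor products are reversed.
theorem comm_comp_coassoc {f : S →ₗ[K] A ⊗[K] B} {g : M →ₗ[K] S ⊗[K] C} {h : T →ₗ[K] B ⊗[K] C}
    {k : M →ₗ[K] A ⊗[K] T}
    (H : TensorProduct.assoc K A B C ∘ₗ f.rTensor C ∘ₗ g = h.lTensor A ∘ₗ k) :
    TensorProduct.assoc K C B A ∘ₗ ((TensorProduct.comm K B C).toLinearMap ∘ₗ h).rTensor A ∘ₗ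
        (TensorProduct.comm K A T).toLinearMap ∘ₗ k
      = ((TensorProduct.comm K A B).toLinearMap ∘ₗ f).lTensor C ∘ₗ
        (TensorProduct.comm K S C).toLinearMap ∘ₗ g := by
  let reversal : A ⊗[K] (B ⊗[K] C) →ₗ[K] C ⊗[K] (B ⊗[K] A) :=
    TensorProduct.assoc K C B A ∘ₗ (TensorProduct.comm K B C).toLinearMap.rTensor A ∘ₗ
      (TensorProduct.comm K A (B ⊗[K] C)).toLinearMap
  have reversal_assoc : reversal ∘ₗ TensorProduct.assoc K A B C
      = (TensorProduct.comm K A B).toLinearMap.lTensor C ∘ₗ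
        (TensorProduct.comm K (A ⊗[K] B) C).toLinearMap := by
    ext a b c
    simp [reversal]
  calc _ = reversal ∘ₗ h.lTensor A ∘ₗ k := by
        rw [LinearMap.rTensor_comp, LinearMap.comp_assoc, ← LinearMap.comp_assoc k,
          LinearMap.rTensor_comp_comm]; rfl
    _ = (reversal ∘ₗ TensorProduct.assoc K A B C) ∘ₗ f.rTensor C ∘ₗ g := by
        rw [← H]; rfl
    _ = _ := by
        rw [reversal_assoc, LinearMap.comp_assoc, ← LinearMap.comp_assoc g,
          ← LinearMap.lTensor_comp_comm, LinearMap.lTensor_comp]; rfl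

theorem lTensor_comp_comm_comp_eq_flip_mk {f : A →ₗ[K] K} {δ : M →ₗ[K] A ⊗[K] M}
    (h : f.rTensor M ∘ₗ δ = TensorProduct.mk K K M 1) :
    f.lTensor M ∘ₗ (TensorProduct.comm K A M).toLinearMap ∘ₗ δ
      = (TensorProduct.mk K M K).flip 1 := by
  rw [← LinearMap.comp_assoc, LinearMap.lTensor_comp_comm, LinearMap.comp_assoc, h]
  rfl

theorem rTensor_comp_comm_comp_eq_mk {f : A →ₗ[K] K} {δ : M →ₗ[K] M ⊗[K] A}
    (h : f.lTensor M ∘ₗ δ = (TensorProduct.mk K M K).flip 1) :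
    f.rTensor M ∘ₗ (TensorProduct.comm K M A).toLinearMap ∘ₗ δ = TensorProduct.mk K K M 1 := by
  rw [← LinearMap.comp_assoc, LinearMap.rTensor_comp_comm, LinearMap.comp_assoc, h]
  rfl

theorem comm_mem_range_rTensor_iff {f : M →ₗ[K] N} {t : A ⊗[K] N} :
    TensorProduct.comm K A N t ∈ LinearMap.range (f.rTensor A)
      ↔ t ∈ LinearMap.range (f.lTensor A) := by
  simp only [LinearMap.mem_range, (TensorProduct.comm K A M).surjective.exists,
    LinearMap.rTensor_comm, EmbeddingLike.apply_eq_iff_eq]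

end Reversal

/-- The co-opposite coalgebra, with comultiplication `c ↦ c₂ ⊗ c₁`. It turns left comodules into
right comodules. -/
def Cop (C : Type*) : Type _ := C

namespace Cop

variable {K C : Type*} [Field K] [AddCommGroup C] [Module K C] [Coalgebra K C]

instance : AddCommGroup (Cop C) := inferInstanceAs (AddCommGroup C)

instance : Module K (Cop C) := inferInstanceAs (Module K C)

noncomputable instance : CoalgebraStruct K (Cop C) where
  comul := ((TensorProduct.comm K C C).toLinearMap ∘ₗ Coalgebra.comul : C →ₗ[K] C ⊗[K] C)
  counit := (Coalgebra.counit : C →ₗ[K] K)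

noncomputable instance : Coalgebra K (Cop C) where
  coassoc := comm_comp_coassoc (Coalgebra.coassoc (R := K) (A := C))
  rTensor_counit_comp_comul :=
    rTensor_comp_comm_comp_eq_mk (Coalgebra.lTensor_counit_comp_comul (R := K) (A := C))
  lTensor_counit_comp_comul :=
    lTensor_comp_comm_comp_eq_flip_mk (Coalgebra.rTensor_counit_comp_comul (R := K) (A := C))

end Cop

namespace LeftComodule

variable {K D M N : Type*} [Field K] [AddCommGroup D] [Module K D] [Coalgebra K D]
  [AddCommGroup M] [Module K M] [AddCommGroup N] [Module K N]

/-- A left comodule as a right comodule over the co-opposite coalgebra. -/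
noncomputable def toRight (P : LeftComodule K D M) : RightComodule K M (Cop D) where
  coact := ((TensorProduct.comm K D M).toLinearMap ∘ₗ P.coact : M →ₗ[K] M ⊗[K] D)
  coassoc := comm_comp_coassoc P.coassoc
  counit_coact := lTensor_comp_comm_comp_eq_flip_mk P.counit_coact

theorem isSubcomodule_toRight_iff {P : LeftComodule K D M} {X : Submodule K M} :
    P.toRight.IsSubcomodule X ↔ P.IsSubcomodule X :=
  forall₂_congr fun _ _ => comm_mem_range_rTensor_iff

theorem isArtinian_toRight_iff {P : LeftComodule K D M} :
    P.toRight.IsArtinian ↔ P.IsArtinian := by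
  rw [IsArtinian, RightComodule.IsArtinian,
    funext fun X => propext (isSubcomodule_toRight_iff (P := P) (X := X))]

theorem isHom_toRight_iff {P : LeftComodule K D M} {Q : LeftComodule K D N} {f : M →ₗ[K] N} :
    P.toRight.IsHom Q.toRight f ↔ P.IsHom Q f := by
  have comm_comp_eq : f.rTensor D ∘ₗ (TensorProduct.comm K D M).toLinearMap ∘ₗ P.coact
      = (TensorProduct.comm K D N).toLinearMap ∘ₗ f.lTensor D ∘ₗ P.coact := by
    rw [← LinearMap.comp_assoc, LinearMap.rTensor_comp_comm, LinearMap.comp_assoc]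
  change (TensorProduct.comm K D N).toLinearMap ∘ₗ Q.coact ∘ₗ f
    = f.rTensor D ∘ₗ (TensorProduct.comm K D M).toLinearMap ∘ₗ P.coact ↔ _
  rw [comm_comp_eq]
  exact LinearMap.cancel_left (TensorProduct.comm K D N).injective

theorem coact_toRight_power (P : LeftComodule K D M) (n : ℕ) :
    (P.toRight.power n).coact = (P.power n).toRight.coact := by
  change ∑ i, (LinearMap.single K (fun _ : Fin n => M) i).rTensor D ∘ₗ
      (TensorProduct.comm K D M).toLinearMap ∘ₗ P.coact ∘ₗ LinearMap.proj i
    = (TensorProduct.comm K D (Fin n → M)).toLinearMap ∘ₗ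
      ∑ i, (LinearMap.single K (fun _ : Fin n => M) i).lTensor D ∘ₗ P.coact ∘ₗ LinearMap.proj i
  refine LinearMap.ext fun x => ?_
  simp only [LinearMap.comp_apply, LinearMap.sum_apply, map_sum, LinearEquiv.coe_coe,
    LinearMap.rTensor_comm]

theorem isFinitelyCogenerated_toRight_iff {P : LeftComodule K D M} :
    P.toRight.IsFinitelyCogenerated ↔ P.IsFinitelyCogenerated := by
  have isHom_iff (n : ℕ) (f : M →ₗ[K] (Fin n → D)) :
      P.toRight.IsHom ((regular K D).toRight.power n) f ↔ P.IsHom ((regular K D).power n) f := by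
    rw [← isHom_toRight_iff, RightComodule.IsHom, coact_toRight_power]; rfl
  exact exists_congr fun n => and_congr_right fun _ =>
    exists_congr fun f => and_congr_left fun _ => isHom_iff n f

end LeftComodule

theorem isRightArtinianCoalgebra_cop_iff {K C : Type*} [Field K] [AddCommGroup C] [Module K C]
    [Coalgebra K C] : IsRightArtinianCoalgebra K (Cop C) ↔ IsLeftArtinianCoalgebra K C :=
  LeftComodule.isArtinian_toRight_iff (P := LeftComodule.regular K C)

/-- A right comodule as a left comodule over the co-opposite coalgebra. -/
noncomputable def RightComodule.toLeft {K E M : Type*} [Field K] [AddCommGroup E] [Module K E]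
    [Coalgebra K E] [AddCommGroup M] [Module K M] (P : RightComodule K M E) :
    LeftComodule K (Cop E) M where
  coact := ((TensorProduct.comm K M E).toLinearMap ∘ₗ P.coact : M →ₗ[K] E ⊗[K] M)
  coassoc := comm_comp_coassoc P.coassoc
  counit_coact := rTensor_comp_comm_comp_eq_mk P.counit_coact

/-- A `D`-`E`-bicomodule as an `Eᶜᵒᵖ`-`Dᶜᵒᵖ`-bicomodule. -/
noncomputable def Bicomodule.cop {K D M E : Type*} [Field K] [AddCommGroup D] [Module K D]
    [Coalgebra K D] [AddCommGroup M] [Module K M] [AddCommGroup E] [Module K E] [Coalgebra K E]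
    (B : Bicomodule K D M E) : Bicomodule K (Cop E) M (Cop D) where
  left := B.right.toLeft
  right := B.left.toRight
  compat := comm_comp_coassoc B.compat

theorem RightComodule.isHom_corestrict_regular {K C D : Type*} [Field K] [AddCommGroup C]
    [Module K C] [Coalgebra K C] [AddCommGroup D] [Module K D] [Coalgebra K D] (φ : C →ₗc[K] D) :
    ((regular K C).corestrict φ).IsHom (regular K D) φ.toLinearMap := by
  change Coalgebra.comul ∘ₗ φ.toLinearMap
    = φ.toLinearMap.rTensor D ∘ₗ φ.toLinearMap.lTensor C ∘ₗ Coalgebra.comul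
  rw [← LinearMap.comp_assoc, LinearMap.rTensor_comp_lTensor, φ.map_comp_comul]

theorem isRightArtinianCoalgebra_iff_of_bijective {K C D : Type*} [Field K] [AddCommGroup C]
    [Module K C] [Coalgebra K C] [AddCommGroup D] [Module K D] [Coalgebra K D] {φ : C →ₗc[K] D}
    (hφ : Function.Bijective φ) :
    IsRightArtinianCoalgebra K C ↔ IsRightArtinianCoalgebra K D := by
  rw [IsRightArtinianCoalgebra, ← RightComodule.isArtinian_corestrict_iff _ hφ.1]
  have h := RightComodule.isHom_corestrict_regular φ
  exact ⟨h.isArtinian_of_surjective hφ.2, h.isArtinian_of_injective hφ.1⟩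

theorem isLeftArtinianCoalgebra_iff_isRightArtinianCoalgebra {K C : Type*} [Field K]
    [AddCommGroup C] [Module K C] [Coalgebra K C] [Coalgebra.IsCocomm K C] :
    IsLeftArtinianCoalgebra K C ↔ IsRightArtinianCoalgebra K C := by
  have isSubcomodule_iff (X : Submodule K C) : (LeftComodule.regular K C).IsSubcomodule X
      ↔ (RightComodule.regular K C).IsSubcomodule X := by
    refine forall₂_congr fun x _ => ?_
    change Coalgebra.comul x ∈ _ ↔ Coalgebra.comul x ∈ _
    rw [← comm_mem_range_rTensor_iff, Coalgebra.comm_comul]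
  rw [IsLeftArtinianCoalgebra, IsRightArtinianCoalgebra, LeftComodule.IsArtinian,
    RightComodule.IsArtinian, funext fun X => propext (isSubcomodule_iff X)]

namespace TriangularComatrix

variable {K D M E : Type*} [Field K] [AddCommGroup D] [Module K D] [Coalgebra K D]
  [AddCommGroup M] [Module K M] [AddCommGroup E] [Module K E] [Coalgebra K E]
  (B : Bicomodule K D M E)

section Desc

variable {V W : Type*} [AddCommGroup V] [Module K V] [AddCommGroup W] [Module K W]
  (f : D →ₗ[K] V) (g : M →ₗ[K] V) (h : E →ₗ[K] V)

theorem comp_desc (k : V →ₗ[K] W) :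
    k ∘ₗ desc B f g h = desc B (k ∘ₗ f) (k ∘ₗ g) (k ∘ₗ h) := by
  apply hom_ext B <;> simp only [LinearMap.comp_assoc, desc_inD, desc_inM, desc_inE]

theorem map_desc_comp_comul (k : TriangularComatrix B →ₗ[K] W) :
    TensorProduct.map (desc B f g h) k ∘ₗ Coalgebra.comul
      = desc B (TensorProduct.map f (k ∘ₗ inD B) ∘ₗ Coalgebra.comul)
        (TensorProduct.map f (k ∘ₗ inM B) ∘ₗ B.left.coact
          + TensorProduct.map g (k ∘ₗ inE B) ∘ₗ B.right.coact)
        (TensorProduct.map h (k ∘ₗ inE B) ∘ₗ Coalgebra.comul) := by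
  apply hom_ext B <;>
  simp only [LinearMap.comp_assoc, desc_inD, desc_inM, desc_inE, comul_comp_inD, comul_comp_inM,
    comul_comp_inE, LinearMap.comp_add] <;>
  simp only [← LinearMap.comp_assoc, ← TensorProduct.map_comp, desc_inD, desc_inM, desc_inE]

end Desc

/-- The inclusion of the upper left corner as a coalgebra morphism. -/
noncomputable def inDHom : D →ₗc[K] TriangularComatrix B :=
  { inD B with
    counit_comp := counit_comp_inD B
    map_comp_comul := (comul_comp_inD B).symm }

/-- The inclusion of the lower right corner as a coalgebra morphism. -/
noncomputable def inEHom : E →ₗc[K] TriangularComatrix B :=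
  { inE B with
    counit_comp := counit_comp_inE B
    map_comp_comul := (comul_comp_inE B).symm }

theorem inDHom_injective : Function.Injective (inDHom B) :=
  Function.LeftInverse.injective (g := desc B LinearMap.id 0 0)
    (LinearMap.congr_fun (desc_inD B _ _ _))

theorem inEHom_injective : Function.Injective (inEHom B) :=
  Function.LeftInverse.injective (g := desc B 0 0 LinearMap.id)
    (LinearMap.congr_fun (desc_inE B _ _ _))

theorem isHom_desc_zero_id_zero : (RightComodule.regular K (TriangularComatrix B)).IsHom
    (B.right.corestrict (inEHom B)) (desc B 0 LinearMap.id 0) := by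
  change ((inE B).lTensor M ∘ₗ B.right.coact) ∘ₗ _ = TensorProduct.map _ _ ∘ₗ Coalgebra.comul
  rw [map_desc_comp_comul, comp_desc]
  simp [LinearMap.lTensor]

theorem isHom_desc_zero_zero_id : (RightComodule.regular K (TriangularComatrix B)).IsHom
    ((RightComodule.regular K E).corestrict (inEHom B)) (desc B 0 0 LinearMap.id) := by
  change ((inE B).lTensor E ∘ₗ Coalgebra.comul) ∘ₗ _ = TensorProduct.map _ _ ∘ₗ Coalgebra.comul
  rw [map_desc_comp_comul, comp_desc]
  simp [LinearMap.lTensor]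

theorem prod_desc_apply (t : TriangularComatrix B) :
    (desc B 0 0 LinearMap.id).prod (desc B 0 LinearMap.id 0) t = (t.2.2, t.2.1) :=
  Prod.ext ((zero_add _).trans (zero_add _)) ((zero_add _).trans (add_zero _))

theorem exact_inD_prod_desc :
    Function.Exact (inD B) ((desc B 0 0 LinearMap.id).prod (desc B 0 LinearMap.id 0)) := by
  intro t
  rw [prod_desc_apply]
  constructor
  · intro h
    exact ⟨t.1, Prod.ext rfl (Prod.ext (congrArg Prod.snd h).symm (congrArg Prod.fst h).symm)⟩
  · rintro ⟨d, rfl⟩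
    rfl

theorem prod_desc_surjective :
    Function.Surjective ((desc B 0 0 LinearMap.id).prod (desc B 0 LinearMap.id 0)) :=
  fun ⟨e, m⟩ => ⟨(0, m, e), prod_desc_apply B _⟩

theorem isRightArtinian_iff : IsRightArtinianCoalgebra K (TriangularComatrix B) ↔
    IsRightArtinianCoalgebra K D ∧ IsRightArtinianCoalgebra K E ∧
      B.right.IsFinitelyCogenerated := by
  have artinian_iff : IsRightArtinianCoalgebra K (TriangularComatrix B) ↔
      IsRightArtinianCoalgebra K D ∧ IsRightArtinianCoalgebra K E ∧ B.right.IsArtinian := by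
    rw [IsRightArtinianCoalgebra, RightComodule.isArtinian_iff_of_exact
      (RightComodule.isHom_corestrict_regular (inDHom B)) (isHom_desc_zero_zero_id B)
      (isHom_desc_zero_id_zero B) (inDHom_injective B) (exact_inD_prod_desc B)
      (prod_desc_surjective B),
      RightComodule.isArtinian_corestrict_iff _ (inDHom_injective B),
      RightComodule.isArtinian_corestrict_iff _ (inEHom_injective B),
      RightComodule.isArtinian_corestrict_iff _ (inEHom_injective B)]
    rfl
  rw [artinian_iff]
  exact and_congr_right fun _ => and_congr_right fun hE =>
    RightComodule.isArtinian_iff_isFinitelyCogenerated hE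

/-- Reflection in the antidiagonal, `(e m; 0 d) ↦ (d m; 0 e)`. -/
def reflection : TriangularComatrix B.cop ≃ₗ[K] TriangularComatrix B where
  toFun t := (t.2.2, t.2.1, t.1)
  invFun t := (t.2.2, t.2.1, t.1)
  map_add' _ _ := rfl
  map_smul' _ _ := rfl

theorem counit_comp_reflection :
    Coalgebra.counit ∘ₗ (reflection B).toLinearMap = Coalgebra.counit := by
  apply hom_ext B.cop
  · exact (counit_comp_inE B).trans (counit_comp_inD B.cop).symm
  · exact (counit_comp_inM B).trans (counit_comp_inM B.cop).symm
  · exact (counit_comp_inD B).trans (counit_comp_inE B.cop).symm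

theorem comul_comp_reflection :
    (TensorProduct.comm K _ _).toLinearMap ∘ₗ Coalgebra.comul ∘ₗ (reflection B).toLinearMap
      = TensorProduct.map (reflection B).toLinearMap (reflection B).toLinearMap ∘ₗ
        Coalgebra.comul := by
  let φ := TensorProduct.map (reflection B).toLinearMap (reflection B).toLinearMap
  apply hom_ext B.cop <;> refine LinearMap.ext fun x => ?_
  · refine .trans (congrArg (TensorProduct.comm K _ _) (comul_inE B x))
      (.trans ?_ (congrArg φ (comul_inD B.cop x)).symm)
    rw [TensorProduct.map_map]
    exact (TensorProduct.map_comm _ _ _).symm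
  · refine .trans (congrArg (TensorProduct.comm K _ _) (comul_inM B x))
      (.trans ?_ (congrArg φ (comul_inM B.cop x)).symm)
    rw [map_add, map_add, TensorProduct.map_map, TensorProduct.map_map, add_comm]
    exact congrArg₂ _ (TensorProduct.map_comm _ _ _).symm (TensorProduct.map_comm _ _ _).symm
  · refine .trans (congrArg (TensorProduct.comm K _ _) (comul_inD B x))
      (.trans ?_ (congrArg φ (comul_inE B.cop x)).symm)
    rw [TensorProduct.map_map]
    exact (TensorProduct.map_comm _ _ _).symm

/-- The reflection as a coalgebra morphism to the co-opposite coalgebra. -/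
noncomputable def reflectionHom : TriangularComatrix B.cop →ₗc[K] Cop (TriangularComatrix B) :=
  { (reflection B).toLinearMap with
    counit_comp := counit_comp_reflection B
    map_comp_comul := (comul_comp_reflection B).symm }

theorem isLeftArtinian_iff : IsLeftArtinianCoalgebra K (TriangularComatrix B) ↔
    IsLeftArtinianCoalgebra K D ∧ IsLeftArtinianCoalgebra K E ∧
      B.left.IsFinitelyCogenerated := by
  rw [← isRightArtinianCoalgebra_cop_iff, ← isRightArtinianCoalgebra_iff_of_bijective
    (φ := reflectionHom B) (reflection B).bijective, isRightArtinian_iff,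
    isRightArtinianCoalgebra_cop_iff, isRightArtinianCoalgebra_cop_iff,
    ← LeftComodule.isFinitelyCogenerated_toRight_iff, and_left_comm]
  rfl

end TriangularComatrix

theorem isLeftArtinianCoalgebra_of_finiteDimensional (K C : Type*) [Field K] [AddCommGroup C]
    [Module K C] [Coalgebra K C] [FiniteDimensional K C] : IsLeftArtinianCoalgebra K C :=
  have : FiniteDimensional K (Cop C) := ‹FiniteDimensional K C›
  isRightArtinianCoalgebra_cop_iff.mp <|
    RightComodule.isArtinian_of_forall_finiteDimensional fun _ _ _ => inferInstance

theorem LeftComodule.IsArtinian.isFinitelyCogenerated {K D M : Type*} [Field K] [AddCommGroup D]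
    [Module K D] [Coalgebra K D] [AddCommGroup M] [Module K M] {P : LeftComodule K D M}
    (h : P.IsArtinian) : P.IsFinitelyCogenerated :=
  isFinitelyCogenerated_toRight_iff.mp (isArtinian_toRight_iff.mpr h).isFinitelyCogenerated

theorem RightComodule.IsFinitelyCogenerated.finiteDimensional {K E M : Type*} [Field K]
    [AddCommGroup E] [Module K E] [Coalgebra K E] [FiniteDimensional K E] [AddCommGroup M]
    [Module K M] {P : RightComodule K M E} (h : P.IsFinitelyCogenerated) :
    FiniteDimensional K M :=
  let ⟨_, _, f, _, h_inj⟩ := h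
  Module.Finite.of_injective f h_inj

namespace TriangularComatrix

variable {K D M : Type*} [Field K] [AddCommGroup D] [Module K D] [Coalgebra K D]
  [AddCommGroup M] [Module K M]

theorem isLeftArtinian_toBicomodule {P : LeftComodule K D M} (hD : IsLeftArtinianCoalgebra K D)
    (hP : P.IsArtinian) : IsLeftArtinianCoalgebra K (TriangularComatrix P.toBicomodule) :=
  (isLeftArtinian_iff _).mpr
    ⟨hD, isLeftArtinianCoalgebra_of_finiteDimensional K K, hP.isFinitelyCogenerated⟩

theorem not_isRightArtinian_toBicomodule {P : LeftComodule K D M} (hM : ¬ FiniteDimensional K M) :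
    ¬ IsRightArtinianCoalgebra K (TriangularComatrix P.toBicomodule) :=
  fun h => hM ((isRightArtinian_iff _).mp h).2.2.finiteDimensional

end TriangularComatrix

namespace DividedPowerCoalgebra

variable (K : Type*) [Field K]

theorem not_finiteDimensional : ¬ FiniteDimensional K (DividedPowerCoalgebra K) := fun _ =>
  (Module.Finite.finite_basis (basis K)).false

instance : Coalgebra.IsCocomm K (DividedPowerCoalgebra K) where
  comm_comp_comul := (basis K).ext fun n => by
    rw [LinearMap.comp_apply, comul_basis, map_sum, ← Finset.Nat.sum_antidiagonal_swap]
    simp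

variable {K}

theorem coord_act_coord (i k : ℕ) (x : DividedPowerCoalgebra K) :
    (basis K).coord i ((RightComodule.regular K _).act ((basis K).coord k) x)
      = (basis K).coord (i + k) x := by
  suffices (basis K).coord i ∘ₗ (RightComodule.regular K _).act ((basis K).coord k)
      = (basis K).coord (i + k) from LinearMap.congr_fun this x
  refine (basis K).ext fun n => ?_
  have coact_basis : (RightComodule.regular K _).coact (basis K n)
      = ∑ p ∈ Finset.HasAntidiagonal.antidiagonal n, basis K p.1 ⊗ₜ[K] basis K p.2 :=
    comul_basis K n
  rw [LinearMap.comp_apply, RightComodule.act_apply, coact_basis]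
  simp only [map_sum, rightSlice_tmul, map_smul, Module.Basis.coord_apply, Module.Basis.repr_self,
    smul_eq_mul, Finsupp.single_apply]
  have indicator_eq (p : ℕ × ℕ) : (if p.2 = k then (1 : K) else 0) * (if p.1 = i then 1 else 0)
      = if p = (i, k) then 1 else 0 := by
    simp [Prod.ext_iff, ← ite_and]
  simp only [indicator_eq, Finset.sum_ite_eq']
  exact if_congr (Finset.HasAntidiagonal.mem_antidiagonal.trans eq_comm) rfl rfl

theorem sum_range_coord_smul {n : ℕ} {x : DividedPowerCoalgebra K}
    (h : ∀ m, n ≤ m → (basis K).coord m x = 0) :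
    ∑ i ∈ Finset.range n, (basis K).coord i x • basis K i = x := by
  have support_subset : ((basis K).repr x).support ⊆ Finset.range n := fun i hi => by
    by_contra h_mem
    exact Finsupp.mem_support_iff.mp hi (h i (by simpa using h_mem))
  conv_rhs => rw [← (basis K).linearCombination_repr x, Finsupp.linearCombination_apply]
  rw [Finsupp.sum_of_support_subset _ support_subset _ (by simp)]
  rfl

theorem basis_mem_of_isSubcomodule {X : Submodule K (DividedPowerCoalgebra K)}
    (hX : (RightComodule.regular K _).IsSubcomodule X) {x : DividedPowerCoalgebra K} (hx : x ∈ X)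
    {N : ℕ} (h_top : (basis K).coord N x ≠ 0) (h_above : ∀ m, N < m → (basis K).coord m x = 0)
    {n : ℕ} (hn : n ≤ N) : basis K n ∈ X := by
  induction n using Nat.strong_induction_on with
  | _ n ih =>
  let y := (RightComodule.regular K _).act ((basis K).coord (N - n)) x
  have hy : y ∈ X := (RightComodule.isSubcomodule_iff_forall_act_mem _).mp hX _ x hx
  have y_eq : ∑ i ∈ Finset.range n, (basis K).coord i y • basis K i
      + (basis K).coord N x • basis K n = y := by
    have coord_n : (basis K).coord n y = (basis K).coord N x := by
      rw [coord_act_coord, Nat.add_sub_cancel' hn]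
    rw [← coord_n, ← Finset.sum_range_succ]
    exact sum_range_coord_smul fun m hm => by
      rw [coord_act_coord, h_above _ (by omega)]
  have h_lower : ∑ i ∈ Finset.range n, (basis K).coord i y • basis K i ∈ X :=
    Submodule.sum_mem _ fun i hi => X.smul_mem _ (ih i (Finset.mem_range.mp hi)
      ((Finset.mem_range.mp hi).le.trans hn))
  rw [← y_eq, Submodule.add_mem_iff_right _ h_lower] at hy
  exact (X.smul_mem_iff h_top).mp hy

theorem finiteDimensional_of_isSubcomodule {X : Submodule K (DividedPowerCoalgebra K)}
    (hX : (RightComodule.regular K _).IsSubcomodule X) (h_ne : X ≠ ⊤) :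
    FiniteDimensional K X := by
  obtain ⟨n, hn⟩ : ∃ n, basis K n ∉ X := by
    by_contra! h
    exact h_ne (top_le_iff.mp ((basis K).span_eq.ge.trans
      (Submodule.span_le.mpr (Set.range_subset_iff.mpr h))))
  have coord_eq_zero {x} (hx : x ∈ X) (m : ℕ) (hm : n ≤ m) : (basis K).coord m x = 0 := by
    by_contra h
    obtain ⟨N, hN, h_max⟩ := ((basis K).repr x).support.exists_max_image id
      ⟨m, Finsupp.mem_support_iff.mpr h⟩
    refine hn (basis_mem_of_isSubcomodule hX hx (Finsupp.mem_support_iff.mp hN) (fun m' hm' => ?_)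
      (hm.trans (h_max m (Finsupp.mem_support_iff.mpr h))))
    exact Finsupp.notMem_support_iff.mp fun h_mem => hm'.not_ge (h_max m' h_mem)
  have le_span : X ≤ Submodule.span K (basis K '' Finset.range n) := fun x hx => by
    rw [← sum_range_coord_smul (coord_eq_zero hx)]
    exact Submodule.sum_mem _ fun i hi =>
      Submodule.smul_mem _ _ (Submodule.subset_span ⟨i, hi, rfl⟩)
  have := FiniteDimensional.span_of_finite K ((Finset.range n).finite_toSet.image (basis K))
  exact Submodule.finiteDimensional_of_le le_span

theorem isRightArtinian : IsRightArtinianCoalgebra K (DividedPowerCoalgebra K) :=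
  RightComodule.isArtinian_of_forall_finiteDimensional fun _ => finiteDimensional_of_isSubcomodule

theorem isLeftArtinian : IsLeftArtinianCoalgebra K (DividedPowerCoalgebra K) :=
  isLeftArtinianCoalgebra_iff_isRightArtinianCoalgebra.mpr isRightArtinian

end DividedPowerCoalgebra

theorem mainTheorem8 {K : Type*} [Field K] :
    -- the criterion for `(D M; 0 E)`, left and right
    (∀ {D : Type*} {M : Type*} {E : Type*} [AddCommGroup D] [Module K D] [Coalgebra K D]
      [AddCommGroup M] [Module K M] [AddCommGroup E] [Module K E] [Coalgebra K E]
      (B : Bicomodule K D M E),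
      (IsLeftArtinianCoalgebra K (TriangularComatrix B) ↔
        IsLeftArtinianCoalgebra K D ∧ IsLeftArtinianCoalgebra K E ∧
          B.left.IsFinitelyCogenerated) ∧
      (IsRightArtinianCoalgebra K (TriangularComatrix B) ↔
        IsRightArtinianCoalgebra K D ∧ IsRightArtinianCoalgebra K E ∧
          B.right.IsFinitelyCogenerated)) ∧
    -- `(D D; 0 K)` is left but not right Artinian if `D` is infinite dimensional and left Artinian
    (∀ {D : Type*} [AddCommGroup D] [Module K D] [Coalgebra K D],
      ¬ FiniteDimensional K D → IsLeftArtinianCoalgebra K D →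
        IsLeftArtinianCoalgebra K
          (TriangularComatrix (LeftComodule.regular K D).toBicomodule) ∧
        ¬ IsRightArtinianCoalgebra K
          (TriangularComatrix (LeftComodule.regular K D).toBicomodule)) ∧
    -- the divided power coalgebra is such a coalgebra `D`
    (¬ FiniteDimensional K (DividedPowerCoalgebra K) ∧
      IsLeftArtinianCoalgebra K (DividedPowerCoalgebra K) ∧
      IsRightArtinianCoalgebra K (DividedPowerCoalgebra K)) ∧
    -- hence a left but not right Artinian coalgebra exists over every field
    (IsLeftArtinianCoalgebra K (TriangularComatrix
        (LeftComodule.regular K (DividedPowerCoalgebra K)).toBicomodule) ∧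
      ¬ IsRightArtinianCoalgebra K (TriangularComatrix
        (LeftComodule.regular K (DividedPowerCoalgebra K)).toBicomodule)) :=
  ⟨fun B => ⟨TriangularComatrix.isLeftArtinian_iff B, TriangularComatrix.isRightArtinian_iff B⟩,
    fun h_inf hD => ⟨TriangularComatrix.isLeftArtinian_toBicomodule hD hD,
      TriangularComatrix.not_isRightArtinian_toBicomodule h_inf⟩,
    ⟨DividedPowerCoalgebra.not_finiteDimensional K, DividedPowerCoalgebra.isLeftArtinian,
      DividedPowerCoalgebra.isRightArtinian⟩,
    TriangularComatrix.isLeftArtinian_toBicomodule DividedPowerCoalgebra.isLeftArtinian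
      DividedPowerCoalgebra.isLeftArtinian,
    TriangularComatrix.not_isRightArtinian_toBicomodule
      (DividedPowerCoalgebra.not_finiteDimensional K)⟩
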